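/- **Theorem 1.** Let $V$ be a finite set (the vertex set of a graph or hypergraph) and let $K$ be a set of colours. A *setting* is a pair $(Z,c)$ with $Z\subseteq V$ and $c:Z\to K$. Let a set of *bad settings* $(Z,c)$ be given, all with $Z\neq\emptyset$. A colouring $f:V\to K$ *avoids* them if $f|_Z\neq c$ for every bad setting $(Z,c)$. Let: 1. $\mathcal Z:=\{Z\subseteq V:\text{ there is } c \text{ such that } (Z,c) \text{ is a bad setting}\}=\{Z_i: i\in I\}$, indexed bijectively by a finite set $I\subset\mathbb N$. 2. For each $i\in I$: (a) $C_i:=\{c: (Z_i,c)\text{ is a bad setting}\}$; (b) $k_i,m_i\in\mathbb N$ be such that for every $v\in Z_i$ there is a set of $k_i$ vertices of $Z_i$, all different from $v$, such that every colouring of these $k_i$ vertices has at most $m_i$ extensions to a colouring $c\in C_i$; (c) $l_i:=|Z_i|-k_i$. 3. $E:=\{l_i: i\in I\}$. 4. For $l\in E$ and $v\in V$, $Q_l(v)$ be the set of those subsets of $V$ that contain $v$ and are equal to some $Z_j\in\mathcal Z$ with $l_j=l$, and $d_l:=\max_{v\in V}|Q_l(v)|$. 5. $\phi_E(x):=1+\sum_{l\in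 E}x^l$, $\tau>0$ be a real number with $\phi_E(\tau)-\tau\phi_E'(\tau)=0$, and $\gamma:=\phi_E'(\tau)$. Put $N:=\big\lceil \gamma\,\sup_{i\in I}(d_{l_i}m_i)^{1/l_i}\big\rceil$. Then there exists a colouring of $V$ with $N$ colours that avoids all bad settings: for every set $S\subseteq K$ of $N$ colours there is $f:V\to S$ that avoids all bad settings. In particular, this applies to the variable version of the Lovász Local Lemma: let $(\psi_v)_{v\in V}$ be independent $K$-valued random variables and let $(A_x)_{x\in X}$ be a finite family of events, where $A_x$ depends only on the variables $\psi_v$ with $v\in\mathrm{vbl}(A_x)\subseteq V$ and occurs exactly when their configuration lies in a set $c(A_x)$. If the bad settings above are the pairs $(\mathrm{vbl}(A_x),c)$ with $x\in X$ and $c\in c(A_x)$, and if each $\psi_v$ takes at least $N$ different values with positive probability, then with positive probability none of the events $A_x$ occurs. -/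

import Mathlib

open MeasureTheory ProbabilityTheory

namespace EntropyCompression

/-- A setting: a set `Z` of vertices together with a colouring of `Z` by colours from `K`. -/
abbrev Setting (V K : Type*) := (Z : Finset V) × ({v // v ∈ Z} → K)

/-- The sets `Z` for which there is a colouring `c` of `Z` such that `(Z, c)` is a bad setting. -/
def badSets {V K : Type*} (bad : Set (Setting V K)) : Set (Finset V) :=
  {Z | ∃ c : {v // v ∈ Z} → K, (⟨Z, c⟩ : Setting V K) ∈ bad}

/-- The bad colourings of the set `Z`. -/
def badColorings {V K : Type*} (bad : Set (Setting V K)) (Z : Finset V) :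
    Set ({v // v ∈ Z} → K) :=
  {c | (⟨Z, c⟩ : Setting V K) ∈ bad}

/-- A colouring of all vertices avoids the bad settings if its restriction to `Z` is different
from `c`, for every bad setting `(Z, c)`. -/
def Avoids {V K : Type*} (bad : Set (Setting V K)) (f : V → K) : Prop :=
  ∀ s ∈ bad, (fun v : {v // v ∈ s.1} => f v) ≠ s.2

/-- For each vertex `v` of `Z` there are `k` vertices of `Z`, different from `v`, such that every
colouring `p` of these vertices has at most `m` extensions to a bad colouring of `Z`. -/
def ExtensionBound {V K : Type*} (bad : Set (Setting V K)) (Z : Finset V) (k m : ℕ) : Prop :=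
  ∀ v ∈ Z, ∃ F : Finset V, F ⊆ Z ∧ v ∉ F ∧ F.card = k ∧
    ∀ p : {u // u ∈ F} → K,
      {c ∈ badColorings bad Z |
        ∀ (u : V) (hu : u ∈ F) (hz : u ∈ Z), c ⟨u, hz⟩ = p ⟨u, hu⟩}.encard ≤ (m : ℕ∞)

/-- `l_i = |Z_i| - k_i`. -/
def lVal {V : Type*} (Z : ℕ → Finset V) (k : ℕ → ℕ) (i : ℕ) : ℕ := (Z i).card - k i

/-- The set `E` of all values `l_i`. -/
def lSet {V : Type*} (I : Finset ℕ) (Z : ℕ → Finset V) (k : ℕ → ℕ) : Finset ℕ :=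
  I.image (lVal Z k)

/-- `Q_l(v)`: the sets of vertices that contain `v` and are equal to some `Z_j` with `l_j = l`. -/
def Q {V : Type*} (I : Finset ℕ) (Z : ℕ → Finset V) (k : ℕ → ℕ) (l : ℕ) (v : V) :
    Set (Finset V) :=
  {Y | v ∈ Y ∧ ∃ j ∈ I, Z j = Y ∧ lVal Z k j = l}

/-- `d_l`, the maximum over the vertices `v` of the number of elements of `Q_l(v)`. -/
noncomputable def d {V : Type*} [Fintype V] (I : Finset ℕ) (Z : ℕ → Finset V) (k : ℕ → ℕ)
    (l : ℕ) : ℕ :=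
  Finset.univ.sup fun v : V => (Q I Z k l v).ncard

/-- `φ_E(x) = 1 + ∑_{l ∈ E} x ^ l`. -/
noncomputable def phi (E : Finset ℕ) (x : ℝ) : ℝ := 1 + ∑ l ∈ E, x ^ l

/-- The number of colours `⌈φ_E'(τ) · sup_{i ∈ I} (d_{l_i} m_i)^{1 / l_i}⌉`. -/
noncomputable def numColors {V : Type*} [Fintype V] (I : Finset ℕ) (Z : ℕ → Finset V)
    (k m : ℕ → ℕ) (τ : ℝ) : ℕ :=
  ⌈deriv (phi (lSet I Z k)) τ *
    ⨆ i : {i // i ∈ I}, ((d I Z k (lVal Z k i) : ℝ) * (m i : ℝ)) ^ (1 / (lVal Z k i : ℝ))⌉₊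

/-- The bad settings of a family of events: the event with index `x` depends on the variables in
`vbl x` and occurs exactly in the configurations in `c x` of these variables. -/
def eventSettings {V K X : Type*} (vbl : X → Finset V) (c : ∀ x, Set ({v // v ∈ vbl x} → K)) :
    Set (Setting V K) :=
  {s | ∃ x, ∃ b ∈ c x, s = ⟨vbl x, b⟩}

end EntropyCompression

/-!
Let `a W` be the number of list colourings of all of `V` that avoid the bad settings supported in
`W`. By induction on `W`, adding a vertex `v` to `W` keeps at least a fraction `ρ = 1 / φ_E(τ)` of
them. Indeed, the lost colourings are bad on some `Z_i ∋ v`. There is a set `D ∋ v` of `l_i`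
vertices of `Z_i` such that recolouring `D` arbitrarily turns them into colourings counted by
`a (W \ D)`, each of which arises at most `m_i` times, while `ρ ^ (l_i - 1) * a (W \ D) ≤ a W` by
induction. Summed over `i`, the losses are at most `(1 - ρ) * a W` once every list has at least
`φ_E(τ) / τ * sup_i (d_{l_i} m_i) ^ (1 / l_i)` colours, and `φ_E(τ) / τ = φ_E'(τ)`. In particular
`a V ≥ ρ ^ |V| * a ∅ > 0`.

For the Local Lemma, the list of `v` consists of the values that `ψ_v` takes with positive
probability.
-/

namespace EntropyCompression

section General

theorem sum_le_of_card_le_of_mul_le {ι R : Type*} [Semiring R] [LinearOrder R]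
    [IsOrderedRing R] {s : Finset ι} {f : ι → R} {n : ℕ} {b : R} (hs : s.card ≤ n)
    (hf : ∀ i ∈ s, 0 ≤ f i) (hb : 0 ≤ b) (h : ∀ i ∈ s, n * f i ≤ b) : ∑ i ∈ s, f i ≤ b := by
  obtain rfl | hne := s.eq_empty_or_nonempty
  · simpa using hb
  obtain ⟨j, hj, hmax⟩ := s.exists_max_image f hne
  calc ∑ i ∈ s, f i ≤ s.card • f j := Finset.sum_le_card_nsmul s f (f j) hmax
    _ = s.card * f j := nsmul_eq_mul _ _
    _ ≤ n * f j := mul_le_mul_of_nonneg_right (Nat.mono_cast hs) (hf j hj)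
    _ ≤ b := h j hj

theorem pow_card_mul_le_of_mul_le_insert {α R : Type*} [DecidableEq α] [Semiring R]
    [PartialOrder R] [IsOrderedRing R] {a : Finset α → R} {ρ : R} (hρ : 0 ≤ ρ)
    {U W : Finset α} (hUW : U ⊆ W)
    (h : ∀ T ⊂ W, ∀ v ∈ W \ T, ρ * a T ≤ a (insert v T)) :
    ρ ^ (W \ U).card * a U ≤ a W := by
  induction W using Finset.strongInduction with
  | H W ih =>
    obtain rfl | hUW := hUW.eq_or_ssubset
    · simp
    obtain ⟨v, hvW, hvU⟩ := Finset.exists_of_ssubset hUW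
    have hss : W.erase v ⊂ W := Finset.erase_ssubset hvW
    have hcard : (W \ U).card = (W.erase v \ U).card + 1 := by
      rw [← Finset.card_erase_add_one (Finset.mem_sdiff.2 ⟨hvW, hvU⟩), Finset.erase_sdiff_comm]
    have hU : ρ ^ (W.erase v \ U).card * a U ≤ a (W.erase v) :=
      ih _ hss (Finset.subset_erase.2 ⟨hUW.subset, hvU⟩) fun T hT u hu =>
        h T (hT.trans hss) u (Finset.sdiff_subset_sdiff hss.subset subset_rfl hu)
    calc ρ ^ (W \ U).card * a U = ρ * (ρ ^ (W.erase v \ U).card * a U) := by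
          rw [hcard, pow_succ', mul_assoc]
      _ ≤ ρ * a (W.erase v) := mul_le_mul_of_nonneg_left hU hρ
      _ ≤ a (insert v (W.erase v)) := h _ hss v (by simp [hvW])
      _ = a W := by rw [Finset.insert_erase hvW]

theorem exists_finset_subset_card_eq_of_le_encard {α : Type*} {s : Set α} {n : ℕ}
    (h : (n : ℕ∞) ≤ s.encard) : ∃ t : Finset α, ↑t ⊆ s ∧ t.card = n := by
  obtain ⟨t, hts, htn⟩ := Set.exists_subset_encard_eq h
  lift t to Finset α using Set.finite_of_encard_eq_coe htn
  rw [Set.encard_coe_eq_coe_finsetCard] at htn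
  exact ⟨t, hts, by exact_mod_cast htn⟩

end General

section Counting

open scoped Finset

variable {V K : Type*} {bad : Set (Setting V K)} {L : V → Finset K}

/-- The bad colourings of `Y` that extend the colouring `p` of `F`; `ExtensionBound` bounds their
number. -/
def badExtensions (bad : Set (Setting V K)) (Y : Finset V) {F : Finset V}
    (p : {u // u ∈ F} → K) : Set ({v // v ∈ Y} → K) :=
  {c ∈ badColorings bad Y | ∀ (u : V) (hu : u ∈ F) (hz : u ∈ Y), c ⟨u, hz⟩ = p ⟨u, hu⟩}

variable [Fintype V] [DecidableEq V]

open scoped Classical in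
/-- The colourings of all of `V` from the lists `L` that avoid the bad settings supported in `W`.
Vertices outside `W` are coloured as well, so that these sets decrease with `W`. -/
noncomputable def avoiders (bad : Set (Setting V K)) (L : V → Finset K) (W : Finset V) :
    Finset (V → K) :=
  {f ∈ Fintype.piFinset L | Avoids {s ∈ bad | s.1 ⊆ W} f}

open scoped Classical in
/-- The members of `avoiders bad L W` that induce a bad colouring of `Y`: for `v ∈ Y`, these are
among the colourings lost when `v` is added to `W`. -/
noncomputable def badAvoiders (bad : Set (Setting V K)) (L : V → Finset K) (W Y : Finset V) :
    Finset (V → K) :=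
  {f ∈ avoiders bad L W | (fun v : {v // v ∈ Y} => f v) ∈ badColorings bad Y}

theorem mem_avoiders {W : Finset V} {f : V → K} :
    f ∈ avoiders bad L W ↔ (∀ v, f v ∈ L v) ∧ Avoids {s ∈ bad | s.1 ⊆ W} f := by
  simp [avoiders]

theorem mem_badAvoiders {W Y : Finset V} {f : V → K} :
    f ∈ badAvoiders bad L W Y ↔
      f ∈ avoiders bad L W ∧ (fun v : {v // v ∈ Y} => f v) ∈ badColorings bad Y := by
  simp [badAvoiders]

theorem mem_avoiders_sdiff {W D : Finset V} {f g : V → K} (hf : f ∈ avoiders bad L W)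
    (hg : ∀ v, g v ∈ L v) (hgf : ∀ u ∉ D, g u = f u) : g ∈ avoiders bad L (W \ D) := by
  refine mem_avoiders.2 ⟨hg, fun s hs hgs => ?_⟩
  refine (mem_avoiders.1 hf).2 s ⟨hs.1, hs.2.trans Finset.sdiff_subset⟩ ?_
  rw [← hgs]
  exact funext fun v => (hgf v (Finset.mem_sdiff.1 (hs.2 v.2)).2).symm

open scoped Classical in
theorem prod_card_le_card_recolorings {W D : Finset V} {f : V → K} (hf : f ∈ avoiders bad L W) :
    ∏ u ∈ D, #(L u) ≤ #{g ∈ avoiders bad L (W \ D) | ∀ u ∉ D, g u = f u} := by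
  have hcard : #(Fintype.piFinset (D.piecewise L fun u => {f u})) = ∏ u ∈ D, #(L u) := by
    simp [Fintype.card_piFinset, Finset.piecewise, apply_ite Finset.card, Finset.prod_ite_mem]
  rw [← hcard]
  refine Finset.card_le_card fun g hg => ?_
  rw [Fintype.mem_piFinset] at hg
  have hgf : ∀ u ∉ D, g u = f u := fun u hu => by simpa [hu] using hg u
  refine Finset.mem_filter.2 ⟨mem_avoiders_sdiff hf (fun u => ?_) hgf, hgf⟩
  by_cases hu : u ∈ D
  · simpa [hu] using hg u
  · exact hgf u hu ▸ (mem_avoiders.1 hf).1 u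

open scoped Classical in
theorem card_badAvoiders_agreeing_le {W Y F : Finset V} {m : ℕ}
    (hm : ∀ p : {u // u ∈ F} → K, (badExtensions bad Y p).encard ≤ m) (g : V → K) :
    #{f ∈ badAvoiders bad L W Y | ∀ u ∉ Y \ F, g u = f u} ≤ m := by
  set A := {f ∈ badAvoiders bad L W Y | ∀ u ∉ Y \ F, g u = f u} with hA
  have hinj : Set.InjOn (fun (f : V → K) (v : {v // v ∈ Y}) => f v) A := by
    intro f hf f' hf' h
    rw [hA, Finset.mem_coe, Finset.mem_filter] at hf hf'
    funext u
    by_cases hu : u ∈ Y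
    · exact congrFun h ⟨u, hu⟩
    · have huF : u ∉ Y \ F := fun h => hu (Finset.mem_sdiff.1 h).1
      rw [← hf.2 u huF, ← hf'.2 u huF]
  have hmaps : (fun (f : V → K) (v : {v // v ∈ Y}) => f v) '' A ⊆
      badExtensions bad Y fun u : {u // u ∈ F} => g u := by
    rintro _ ⟨f, hf, rfl⟩
    rw [hA, Finset.mem_coe, Finset.mem_filter, mem_badAvoiders] at hf
    exact ⟨hf.1.2, fun u hu _ => (hf.2 u fun h => (Finset.mem_sdiff.1 h).2 hu).symm⟩
  have hcard := (Set.encard_le_encard hmaps).trans (hm _)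
  rw [hinj.encard_image, Set.encard_coe_eq_coe_finsetCard] at hcard
  exact_mod_cast hcard

theorem card_badAvoiders_mul_prod_card_le {Y F : Finset V} {m : ℕ} (W : Finset V)
    (hm : ∀ p : {u // u ∈ F} → K, (badExtensions bad Y p).encard ≤ m) :
    #(badAvoiders bad L W Y) * ∏ u ∈ Y \ F, #(L u) ≤ #(avoiders bad L (W \ (Y \ F))) * m := by
  classical
  exact Finset.card_mul_le_card_mul (fun f g : V → K => ∀ u ∉ Y \ F, g u = f u)
    (fun _ hf => prod_card_le_card_recolorings (mem_badAvoiders.1 hf).1)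
    fun g _ => card_badAvoiders_agreeing_le hm g

theorem card_badAvoiders_le {W Y : Finset V} {k m : ℕ} (h : ExtensionBound bad Y k m)
    {ρ x : ℝ} (hρ : 0 ≤ ρ) (hρ1 : ρ ≤ 1) (hx : 0 < x) (hL : ∀ v, x ≤ ρ * #(L v))
    {v : V} (hvY : v ∈ Y) (hvW : v ∉ W)
    (hW : ∀ U ⊆ W, ρ ^ #(W \ U) * #(avoiders bad L U) ≤ (#(avoiders bad L W) : ℝ)) :
    (#(badAvoiders bad L W Y) : ℝ) ≤ ρ * (m / x ^ (#Y - k)) * #(avoiders bad L W) := by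
  obtain ⟨F, hFY, hvF, rfl, hF⟩ := h v hvY
  rw [← Finset.card_sdiff_of_subset hFY]
  have hcount : (#(badAvoiders bad L W Y) : ℝ) * ∏ u ∈ Y \ F, (#(L u) : ℝ) ≤
      #(avoiders bad L (W \ (Y \ F))) * m := by
    exact_mod_cast card_badAvoiders_mul_prod_card_le W hF
  have hvD : v ∈ Y \ F := Finset.mem_sdiff.2 ⟨hvY, hvF⟩
  generalize Y \ F = D at hcount hvD ⊢
  have hxD : x ^ #D ≤ ρ ^ #D * ∏ u ∈ D, (#(L u) : ℝ) := by
    rw [← Finset.prod_const, ← Finset.prod_const, ← Finset.prod_mul_distrib]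
    exact Finset.prod_le_prod (fun _ _ => hx.le) fun u _ => hL u
  have hlt : #(W \ (W \ D)) < #D := by
    rw [sdiff_sdiff_right_self]
    exact Finset.card_lt_card <| Finset.ssubset_iff_subset_ne.2
      ⟨Finset.inter_subset_right, fun h => hvW (Finset.inter_eq_right.1 h hvD)⟩
  rw [mul_div_assoc', div_mul_eq_mul_div, le_div_iff₀ (by positivity)]
  calc #(badAvoiders bad L W Y) * x ^ #D
      ≤ #(badAvoiders bad L W Y) * (ρ ^ #D * ∏ u ∈ D, (#(L u) : ℝ)) := by gcongr
    _ = ρ ^ #D * (#(badAvoiders bad L W Y) * ∏ u ∈ D, (#(L u) : ℝ)) := by ring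
    _ ≤ ρ ^ (#(W \ (W \ D)) + 1) * (#(avoiders bad L (W \ D)) * m) := by
      gcongr ?_ * ?_
      exact pow_le_pow_of_le_one hρ hρ1 hlt
    _ = ρ * m * (ρ ^ #(W \ (W \ D)) * #(avoiders bad L (W \ D))) := by ring
    _ ≤ ρ * m * #(avoiders bad L W) := by
      gcongr
      exact hW _ Finset.sdiff_subset

variable {ι : Type*} {I : Finset ι} {Z : ι → Finset V} {k m : ι → ℕ}

theorem avoiders_subset_union [DecidableEq (V → K)] (hZ : badSets bad ⊆ Z '' I)
    (W : Finset V) (v : V) :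
    avoiders bad L W ⊆ avoiders bad L (insert v W) ∪
      {i ∈ I | v ∈ Z i}.biUnion fun i => badAvoiders bad L W (Z i) := by
  intro f hf
  by_cases hins : f ∈ avoiders bad L (insert v W)
  · exact Finset.mem_union_left _ hins
  obtain ⟨hfL, hfW⟩ := mem_avoiders.1 hf
  obtain ⟨⟨Y, c⟩, ⟨hbad, hYW⟩, hfc⟩ : ∃ s ∈ {s ∈ bad | s.1 ⊆ insert v W},
      (fun u : {u // u ∈ s.1} => f u) = s.2 := by
    simpa only [mem_avoiders, hfL, implies_true, true_and, Avoids, not_forall, not_not, ne_eq,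
      exists_prop] using hins
  have hvY : v ∈ Y := by
    by_contra hvY
    exact hfW ⟨Y, c⟩ ⟨hbad, (Finset.subset_insert_iff_of_notMem hvY).1 hYW⟩ hfc
  obtain ⟨i, hi, rfl⟩ := hZ ⟨c, hbad⟩
  refine Finset.mem_union_right _ <| Finset.mem_biUnion.2
    ⟨i, Finset.mem_filter.2 ⟨hi, hvY⟩, mem_badAvoiders.2 ⟨hf, ?_⟩⟩
  exact hfc.symm ▸ hbad

theorem card_avoiders_le_add_sum (hZ : badSets bad ⊆ Z '' I) (W : Finset V) (v : V) :
    #(avoiders bad L W) ≤ #(avoiders bad L (insert v W)) +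
      ∑ i ∈ I with v ∈ Z i, #(badAvoiders bad L W (Z i)) := by
  classical
  calc #(avoiders bad L W)
      ≤ _ := Finset.card_le_card (avoiders_subset_union hZ W v)
    _ ≤ _ := Finset.card_union_le _ _
    _ ≤ _ := Nat.add_le_add_left Finset.card_biUnion_le _

theorem mul_card_avoiders_le_card_avoiders_insert (hZ : badSets bad ⊆ Z '' I)
    (hkm : ∀ i ∈ I, ExtensionBound bad (Z i) (k i) (m i))
    {ρ x : ℝ} (hρ : 0 ≤ ρ) (hx : 0 < x) (hL : ∀ v, x ≤ ρ * #(L v))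
    (hw : ∀ v, ρ * (1 + ∑ i ∈ I with v ∈ Z i, m i / x ^ (#(Z i) - k i)) ≤ 1)
    (W : Finset V) {v : V} (hv : v ∉ W) :
    ρ * #(avoiders bad L W) ≤ (#(avoiders bad L (insert v W)) : ℝ) := by
  induction W using Finset.strongInduction generalizing v with
  | H W ih =>
    have hW : ∀ U ⊆ W, ρ ^ #(W \ U) * #(avoiders bad L U) ≤ (#(avoiders bad L W) : ℝ) :=
      fun U hU => pow_card_mul_le_of_mul_le_insert (a := fun U => (#(avoiders bad L U) : ℝ)) hρ hU
        fun T hT u hu => ih T hT (Finset.mem_sdiff.1 hu).2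
    set s : ℝ := ∑ i ∈ I with v ∈ Z i, m i / x ^ (#(Z i) - k i) with hs
    have hs0 : 0 ≤ s := Finset.sum_nonneg fun i _ => by positivity
    have hρ1 : ρ ≤ 1 := (le_mul_of_one_le_right hρ (by linarith)).trans (hw v)
    have hlost : ∑ i ∈ I with v ∈ Z i, (#(badAvoiders bad L W (Z i)) : ℝ) ≤
        ρ * s * #(avoiders bad L W) := by
      rw [hs, Finset.mul_sum, Finset.sum_mul]
      refine Finset.sum_le_sum fun i hi => ?_
      obtain ⟨hiI, hvi⟩ := Finset.mem_filter.1 hi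
      exact card_badAvoiders_le (hkm i hiI) hρ hρ1 hx hL hvi hv hW
    have hsplit : (#(avoiders bad L W) : ℝ) ≤ #(avoiders bad L (insert v W)) +
        ∑ i ∈ I with v ∈ Z i, (#(badAvoiders bad L W (Z i)) : ℝ) := by
      exact_mod_cast card_avoiders_le_add_sum hZ W v
    have hwW : ρ * (1 + s) * #(avoiders bad L W) ≤ 1 * #(avoiders bad L W) := by
      gcongr
      exact hw v
    linarith

end Counting

theorem exists_avoids_of_weight_le {V K ι : Type*} [Finite V] [DecidableEq V]
    {bad : Set (Setting V K)} {L : V → Finset K} {I : Finset ι} {Z : ι → Finset V}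
    {k m : ι → ℕ} (hne : ∀ s ∈ bad, s.1.Nonempty) (hZ : badSets bad ⊆ Z '' I)
    (hkm : ∀ i ∈ I, ExtensionBound bad (Z i) (k i) (m i))
    {ρ x : ℝ} (hρ : 0 < ρ) (hx : 0 < x) (hL : ∀ v, x ≤ ρ * (L v).card)
    (hw : ∀ v, ρ * (1 + ∑ i ∈ I with v ∈ Z i, m i / x ^ ((Z i).card - k i)) ≤ 1) :
    ∃ f : V → K, (∀ v, f v ∈ L v) ∧ Avoids bad f := by
  have := Fintype.ofFinite V
  have hempty : (avoiders bad L ∅).Nonempty := by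
    have hLne : ∀ v, (L v).Nonempty := fun v => by
      have hρL : 0 < ρ * (L v).card := hx.trans_le (hL v)
      exact Finset.card_pos.1 (Nat.cast_pos.1 (pos_of_mul_pos_right hρL hρ.le))
    choose g hg using hLne
    exact ⟨g, mem_avoiders.2 ⟨hg, fun s hs _ =>
      (hne s hs.1).ne_empty (Finset.subset_empty.1 hs.2)⟩⟩
  have hchain : ρ ^ (Finset.univ \ ∅ : Finset V).card * (avoiders bad L ∅).card ≤
      ((avoiders bad L Finset.univ).card : ℝ) :=
    pow_card_mul_le_of_mul_le_insert (a := fun U => ((avoiders bad L U).card : ℝ)) hρ.le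
      (Finset.empty_subset _) fun T _ v hv =>
        mul_card_avoiders_le_card_avoiders_insert hZ hkm hρ.le hx hL hw T (Finset.mem_sdiff.1 hv).2
  have hpos : (0 : ℝ) < (avoiders bad L Finset.univ).card :=
    (mul_pos (pow_pos hρ _) (Nat.cast_pos.2 hempty.card_pos)).trans_le hchain
  obtain ⟨f, hf⟩ := Finset.card_pos.1 (Nat.cast_pos.1 hpos)
  obtain ⟨hfL, hfbad⟩ := mem_avoiders.1 hf
  exact ⟨f, hfL, fun s hs => hfbad s ⟨hs, Finset.subset_univ _⟩⟩

section Parameters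

variable {V K : Type*} {bad : Set (Setting V K)}

theorem ExtensionBound.lt_card {Y : Finset V} {k m : ℕ} (h : ExtensionBound bad Y k m)
    (hne : Y.Nonempty) : k < Y.card := by
  obtain ⟨v, hv⟩ := hne
  obtain ⟨F, hFY, hvF, rfl, -⟩ := h v hv
  exact Finset.card_lt_card (Finset.ssubset_iff_subset_ne.2 ⟨hFY, fun h => hvF (h ▸ hv)⟩)

theorem ExtensionBound.pos {Y : Finset V} {k m : ℕ} (h : ExtensionBound bad Y k m)
    (hne : Y.Nonempty) (hY : Y ∈ badSets bad) : 0 < m := by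
  obtain ⟨v, hv⟩ := hne
  obtain ⟨c, hc⟩ := hY
  obtain ⟨F, hFY, -, -, hF⟩ := h v hv
  have hmem : c ∈ badExtensions bad Y fun u : {u // u ∈ F} => c ⟨u, hFY u.2⟩ :=
    ⟨hc, fun _ _ _ => rfl⟩
  have hcard : (1 : ℕ∞) ≤ m :=
    (Set.one_le_encard_iff_nonempty.2 ⟨c, hmem⟩).trans (hF fun u => c ⟨u, hFY u.2⟩)
  exact_mod_cast hcard

theorem one_le_phi (E : Finset ℕ) {x : ℝ} (hx : 0 ≤ x) : 1 ≤ phi E x :=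
  le_add_of_nonneg_right (Finset.sum_nonneg fun l _ => pow_nonneg hx l)

theorem nonempty_of_phi_le {E : Finset ℕ} {x : ℝ} (h : phi E x ≤ x * deriv (phi E) x) :
    E.Nonempty := by
  rw [Finset.nonempty_iff_ne_empty]
  rintro rfl
  have hphi : phi ∅ = fun _ => 1 := by
    funext y
    simp [phi]
  norm_num [hphi] at h

variable [Fintype V] {I : Finset ℕ} {Z : ℕ → Finset V} {k m : ℕ → ℕ}

theorem ncard_Q_le_d (I : Finset ℕ) (Z : ℕ → Finset V) (k : ℕ → ℕ) (l : ℕ) (v : V) :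
    (Q I Z k l v).ncard ≤ d I Z k l :=
  Finset.le_sup (f := fun v : V => (Q I Z k l v).ncard) (Finset.mem_univ v)

theorem card_filter_le_d [DecidableEq V] (hZ : Set.InjOn Z I) (k : ℕ → ℕ) (l : ℕ) (v : V) :
    (I.filter fun i => v ∈ Z i ∧ lVal Z k i = l).card ≤ d I Z k l := by
  refine le_trans ?_ (ncard_Q_le_d I Z k l v)
  rw [← Set.ncard_coe_finset, ← Set.InjOn.ncard_image (f := Z)]
  · refine Set.ncard_le_ncard ?_ (Set.toFinite _)
    rintro _ ⟨i, hi, rfl⟩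
    obtain ⟨hiI, hvi, hil⟩ := Finset.mem_filter.1 hi
    exact ⟨hvi, i, hiI, rfl, hil⟩
  · exact hZ.mono fun i hi => (Finset.mem_filter.1 hi).1

theorem d_pos (k : ℕ → ℕ) {i : ℕ} (hi : i ∈ I) (hne : (Z i).Nonempty) :
    0 < d I Z k (lVal Z k i) := by
  obtain ⟨v, hv⟩ := hne
  refine lt_of_lt_of_le ?_ (ncard_Q_le_d I Z k _ v)
  exact (Set.ncard_pos (Set.toFinite _)).2 ⟨Z i, hv, i, hi, rfl, rfl⟩

theorem one_add_sum_div_pow_le_phi [DecidableEq V] (hZ : Set.InjOn Z I) {T τ : ℝ}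
    (hT : 0 < T) (hτ : 0 < τ)
    (hdm : ∀ i ∈ I, (d I Z k (lVal Z k i) : ℝ) * m i ≤ T ^ lVal Z k i) (v : V) :
    1 + ∑ i ∈ I with v ∈ Z i, m i / (T / τ) ^ lVal Z k i ≤ phi (lSet I Z k) τ := by
  unfold phi
  gcongr
  rw [← Finset.sum_fiberwise_of_maps_to (t := lSet I Z k) (g := lVal Z k)
    fun i hi => Finset.mem_image_of_mem _ (Finset.mem_filter.1 hi).1]
  refine Finset.sum_le_sum fun l _ => ?_
  rw [Finset.filter_filter]
  have hfiber : ∑ i ∈ I with v ∈ Z i ∧ lVal Z k i = l, (m i : ℝ) ≤ T ^ l := by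
    refine sum_le_of_card_le_of_mul_le (card_filter_le_d hZ k l v) (fun i _ => by positivity)
      (by positivity) fun i hi => ?_
    obtain ⟨hiI, -, rfl⟩ := Finset.mem_filter.1 hi
    exact hdm i hiI
  calc ∑ i ∈ I with v ∈ Z i ∧ lVal Z k i = l, m i / (T / τ) ^ lVal Z k i
      = (∑ i ∈ I with v ∈ Z i ∧ lVal Z k i = l, (m i : ℝ)) / (T / τ) ^ l := by
        rw [Finset.sum_div]
        exact Finset.sum_congr rfl fun i hi => by rw [(Finset.mem_filter.1 hi).2.2]
    _ ≤ T ^ l / (T / τ) ^ l := by gcongr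
    _ = τ ^ l := by rw [← div_pow, div_div_cancel₀ hT.ne']

theorem exists_avoids_of_phi_mul_le (hne : ∀ s ∈ bad, s.1.Nonempty)
    (hZ : Set.InjOn Z I) (hbad : badSets bad ⊆ Z '' I)
    (hkm : ∀ i ∈ I, ExtensionBound bad (Z i) (k i) (m i)) {T τ : ℝ} (hT : 0 < T) (hτ : 0 < τ)
    (hdm : ∀ i ∈ I, (d I Z k (lVal Z k i) : ℝ) * m i ≤ T ^ lVal Z k i)
    {L : V → Finset K} (hL : ∀ v, phi (lSet I Z k) τ * T ≤ τ * (L v).card) :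
    ∃ f : V → K, (∀ v, f v ∈ L v) ∧ Avoids bad f := by
  classical
  have hφ : 0 < phi (lSet I Z k) τ := zero_lt_one.trans_le (one_le_phi _ hτ.le)
  refine exists_avoids_of_weight_le hne hbad hkm (ρ := (phi (lSet I Z k) τ)⁻¹) (x := T / τ)
    (by positivity) (by positivity) (fun v => ?_) fun v => ?_
  · rw [inv_mul_eq_div, div_le_div_iff₀ hτ hφ]
    linarith [hL v]
  · exact (inv_mul_le_one₀ hφ).2 (one_add_sum_div_pow_le_phi hZ hT hτ hdm v)

/-- The supremum `sup_{i ∈ I} (d_{l_i} m_i)^{1 / l_i}` in `numColors`; as a supremum of reals it is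
`0` for empty `I`. -/
noncomputable def supRoot (I : Finset ℕ) (Z : ℕ → Finset V) (k m : ℕ → ℕ) : ℝ :=
  ⨆ i : {i // i ∈ I}, ((d I Z k (lVal Z k i) : ℝ) * (m i : ℝ)) ^ (1 / (lVal Z k i : ℝ))

theorem rpow_le_supRoot {i : ℕ} (hi : i ∈ I) :
    ((d I Z k (lVal Z k i) : ℝ) * (m i : ℝ)) ^ (1 / (lVal Z k i : ℝ)) ≤ supRoot I Z k m :=
  le_ciSup (f := fun i : {i // i ∈ I} =>
    ((d I Z k (lVal Z k i) : ℝ) * (m i : ℝ)) ^ (1 / (lVal Z k i : ℝ)))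
    (Set.finite_range _).bddAbove ⟨i, hi⟩

theorem d_mul_le_supRoot_pow {i : ℕ} (hi : i ∈ I) (hl : lVal Z k i ≠ 0) :
    (d I Z k (lVal Z k i) : ℝ) * m i ≤ supRoot I Z k m ^ lVal Z k i := by
  have h := pow_le_pow_left₀ (by positivity) (rpow_le_supRoot (Z := Z) (k := k) (m := m) hi)
    (lVal Z k i)
  rwa [one_div, Real.rpow_inv_natCast_pow (by positivity) hl] at h

theorem supRoot_pos {i : ℕ} (hi : i ∈ I) (hne : (Z i).Nonempty) (hm : 0 < m i) :
    0 < supRoot I Z k m := by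
  have hd : 0 < d I Z k (lVal Z k i) := d_pos k hi hne
  exact lt_of_lt_of_le (by positivity) (rpow_le_supRoot hi)

theorem deriv_phi_mul_supRoot_le_numColors (I : Finset ℕ) (Z : ℕ → Finset V) (k m : ℕ → ℕ)
    (τ : ℝ) : deriv (phi (lSet I Z k)) τ * supRoot I Z k m ≤ numColors I Z k m τ :=
  Nat.le_ceil _

theorem exists_avoids_of_numColors_le_encard (hne : ∀ s ∈ bad, s.1.Nonempty)
    (hZ : Set.BijOn Z (I : Set ℕ) (badSets bad))
    (hkm : ∀ i ∈ I, ExtensionBound bad (Z i) (k i) (m i)) {τ : ℝ} (hτ : 0 < τ)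
    (hτE : phi (lSet I Z k) τ ≤ τ * deriv (phi (lSet I Z k)) τ)
    {L : V → Set K} (hL : ∀ v, (numColors I Z k m τ : ℕ∞) ≤ (L v).encard) :
    ∃ f : V → K, (∀ v, f v ∈ L v) ∧ Avoids bad f := by
  have hZne : ∀ i ∈ I, (Z i).Nonempty := fun i hi => (hZ.mapsTo hi).elim fun _ hc => hne _ hc
  have hT : 0 < supRoot I Z k m := by
    obtain ⟨i, hi⟩ := Finset.image_nonempty.1 (nonempty_of_phi_le hτE)
    exact supRoot_pos hi (hZne i hi) ((hkm i hi).pos (hZne i hi) (hZ.mapsTo hi))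
  have hdm : ∀ i ∈ I, (d I Z k (lVal Z k i) : ℝ) * m i ≤ supRoot I Z k m ^ lVal Z k i :=
    fun i hi => d_mul_le_supRoot_pow hi (Nat.sub_pos_of_lt ((hkm i hi).lt_card (hZne i hi))).ne'
  have hN : phi (lSet I Z k) τ * supRoot I Z k m ≤ τ * numColors I Z k m τ := by
    calc phi (lSet I Z k) τ * supRoot I Z k m
        ≤ τ * deriv (phi (lSet I Z k)) τ * supRoot I Z k m := by gcongr
      _ ≤ τ * numColors I Z k m τ := by
        rw [mul_assoc]
        gcongr
        exact deriv_phi_mul_supRoot_le_numColors I Z k m τ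
  choose S hSL hS using fun v => exists_finset_subset_card_eq_of_le_encard (hL v)
  obtain ⟨f, hfS, hf⟩ := exists_avoids_of_phi_mul_le hne hZ.injOn hZ.surjOn hkm hT hτ hdm
    (L := S) fun v => by rwa [hS v]
  exact ⟨f, fun v => hSL v (hfS v), hf⟩

end Parameters

section Probability

theorem measure_iInter_preimage_pos {V Ω : Type*} {K : V → Type*} [Finite V] [MeasurableSpace Ω]
    {P : Measure Ω} [∀ v, MeasurableSpace (K v)] {ψ : ∀ v, Ω → K v} (hψ : iIndepFun ψ P)
    {s : ∀ v, Set (K v)} (hs : ∀ v, MeasurableSet (s v)) (hpos : ∀ v, P (ψ v ⁻¹' s v) ≠ 0) :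
    0 < P (⋂ v, ψ v ⁻¹' s v) := by
  have := Fintype.ofFinite V
  rw [hψ.meas_iInter fun v => ⟨s v, hs v, rfl⟩, pos_iff_ne_zero]
  exact Finset.prod_ne_zero_iff.2 fun v _ => hpos v

theorem measure_iInter_compl_pos_of_avoids {V K Ω X : Type*} [Finite V] [MeasurableSpace Ω]
    {P : Measure Ω} [MeasurableSpace K] [MeasurableSingletonClass K] {ψ : V → Ω → K}
    (hψ : iIndepFun ψ P) {A : X → Set Ω} {vbl : X → Finset V}
    {c : ∀ x, Set ({v // v ∈ vbl x} → K)}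
    (hA : ∀ x, A x = {ω | (fun v : {v // v ∈ vbl x} => ψ v ω) ∈ c x})
    {f : V → K} (hf : Avoids (eventSettings vbl c) f) (hpos : ∀ v, P (ψ v ⁻¹' {f v}) ≠ 0) :
    0 < P (⋂ x, (A x)ᶜ) := by
  refine (measure_iInter_preimage_pos hψ (fun v => measurableSet_singleton (f v)) hpos).trans_le
    (measure_mono fun ω hω => Set.mem_iInter.2 fun x hx => ?_)
  have hψf : ∀ v, ψ v ω = f v := Set.mem_iInter.1 hω
  rw [hA x, Set.mem_ofPred_eq] at hx
  simp only [hψf] at hx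
  exact hf _ ⟨x, _, hx, rfl⟩ rfl

end Probability

end EntropyCompression

theorem theorem1_general {V : Type*} [Fintype V] {K : Type*}
    (bad : Set (EntropyCompression.Setting V K))
    (hne : ∀ s ∈ bad, s.1.Nonempty)
    (I : Finset ℕ) (Z : ℕ → Finset V)
    (hZ : Set.BijOn Z (I : Set ℕ) (EntropyCompression.badSets bad))
    (k m : ℕ → ℕ)
    (hkm : ∀ i ∈ I, EntropyCompression.ExtensionBound bad (Z i) (k i) (m i))
    (τ : ℝ) (hτ : 0 < τ)
    (hτE : EntropyCompression.phi (EntropyCompression.lSet I Z k) τ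
      ≤ τ * deriv (EntropyCompression.phi (EntropyCompression.lSet I Z k)) τ) :
    (∀ L : V → Set K, (∀ v, (EntropyCompression.numColors I Z k m τ : ℕ∞) ≤ (L v).encard) →
      ∃ f : V → K, (∀ v, f v ∈ L v) ∧ EntropyCompression.Avoids bad f) ∧
    (∀ {Ω : Type*} [MeasurableSpace Ω] (P : Measure Ω)
        [MeasurableSpace K] [MeasurableSingletonClass K]
        (ψ : V → Ω → K) (_ : iIndepFun ψ P)
        {X : Type*} (A : X → Set Ω) (vbl : X → Finset V)
        (c : ∀ x, Set ({v // v ∈ vbl x} → K))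
        (_ : ∀ x, A x = {ω | (fun v : {v // v ∈ vbl x} => ψ v ω) ∈ c x})
        (_ : EntropyCompression.eventSettings vbl c = bad)
        (_ : ∀ v, (EntropyCompression.numColors I Z k m τ : ℕ∞)
          ≤ {a : K | P (ψ v ⁻¹' {a}) ≠ 0}.encard),
      0 < P (⋂ x, (A x)ᶜ)) := by
  refine ⟨fun L hL => EntropyCompression.exists_avoids_of_numColors_le_encard hne hZ hkm hτ hτE hL,
    fun P _ _ ψ hψ _ A vbl c hA hbad hval => ?_⟩
  obtain ⟨f, hfpos, hf⟩ :=
    EntropyCompression.exists_avoids_of_numColors_le_encard hne hZ hkm hτ hτE hval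
  exact EntropyCompression.measure_iInter_compl_pos_of_avoids hψ hA (hbad ▸ hf) hfpos

theorem theorem1 {V : Type*} [Fintype V] {K : Type*}
    (bad : Set (EntropyCompression.Setting V K))
    (hne : ∀ s ∈ bad, s.1.Nonempty)
    (I : Finset ℕ) (Z : ℕ → Finset V)
    (hZ : Set.BijOn Z (I : Set ℕ) (EntropyCompression.badSets bad))
    (k m : ℕ → ℕ)
    (hkm : ∀ i ∈ I, EntropyCompression.ExtensionBound bad (Z i) (k i) (m i))
    (τ : ℝ) (hτ : 0 < τ)
    (hτE : EntropyCompression.phi (EntropyCompression.lSet I Z k) τ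
      - τ * deriv (EntropyCompression.phi (EntropyCompression.lSet I Z k)) τ = 0) :
    -- a colouring from any palette of the given number of colours
    (∀ S : Finset K, S.card = EntropyCompression.numColors I Z k m τ →
      ∃ f : V → K, (∀ v, f v ∈ S) ∧ EntropyCompression.Avoids bad f) ∧
    -- the variable version of the Local Lemma: independent variables indexed by `V`
    (∀ {Ω : Type*} [MeasurableSpace Ω] (P : Measure Ω) [IsProbabilityMeasure P]
        [MeasurableSpace K] [MeasurableSingletonClass K]
        (ψ : V → Ω → K) (_ : ∀ v, Measurable (ψ v)) (_ : iIndepFun ψ P)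
        {X : Type*} [Finite X] (A : X → Set Ω) (vbl : X → Finset V)
        (c : ∀ x, Set ({v // v ∈ vbl x} → K))
        (_ : ∀ x, A x = {ω | (fun v : {v // v ∈ vbl x} => ψ v ω) ∈ c x})
        (_ : EntropyCompression.eventSettings vbl c = bad)
        (_ : ∀ v, (EntropyCompression.numColors I Z k m τ : ℕ∞)
          ≤ {a : K | P (ψ v ⁻¹' {a}) ≠ 0}.encard),
      0 < P (⋂ x, (A x)ᶜ)) := by
  have ⟨hlist, hlocal⟩ := theorem1_general bad hne I Z hZ k m hkm τ hτ (sub_eq_zero.1 hτE).le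
  exact ⟨fun S hS => hlist (fun _ => S) fun _ => by simp [hS],
    fun P _ _ _ ψ _ hψ _ _ A vbl c => hlocal P ψ hψ A vbl c⟩
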